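/- Let $k\in\{1,2,3,\dots\}\cup\{\infty\}$. Let $I\subseteq\mathbb R$ be an open interval, $\mathcal D_0\subseteq\mathbb R^3$ an open set, and let a fluid motion be given: a map $(t,X)\mapsto\varphi_t(X)\in\mathbb R^3$ of class $C^{k+1}$ on $I\times\mathcal D_0$ such that each $\varphi_t$ is a diffeomorphism of $\mathcal D_0$ onto an open set $\mathcal D_t=\varphi_t(\mathcal D_0)$. Put $F=\partial\varphi_t(X)/\partial X$, $\mathcal W=\{(t,x): t\in I,\ x\in\mathcal D_t\}$, and let $d/dt$ denote the time derivative at fixed $X$, i.e. along $t\mapsto(t,\varphi_t(X))$ (the material derivative). The Lie derivatives with respect to the space-time velocity $\mathcal U=(1,u)$, where $u$ is the velocity of the fluid, are, at the point $(t,\varphi_t(X))$: $$d_L s=\frac{ds}{dt},\qquad d_L J=F\,\frac{d}{dt}\bigl(F^{-1}J\bigr),\qquad d_L(\rho\det)=\frac{1}{\det F}\,\frac{d}{dt}\bigl(\rho\,\det F\bigr)\,\det$$ for a scalar field $s$, a vector field $J$, and a $3$-form $\rho\det$ given by a scalar field $\rho$. A field moves with the fluid if its Lie derivative is zero. **Theorem.**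 Let $\rho,s:\mathcal W\to\mathbb R$ and $J:\mathcal W\to\mathbb R^3$ with $\rho,J$ of class $C^k$ and $s$ of class $C^{k+1}$. Suppose that the $3$-form $\rho\det$, the scalar field $s$ and the vector field $J$ all move with the fluid, and that, on $\mathcal W$, $$\frac{\partial s}{\partial x}\,J=0\qquad\text{and}\qquad \operatorname{div}(\rho J)=0 .$$ Then, locally near every particle at which $\operatorname{grad}s\neq0$, there are a scalar field $\eta$ moving with the fluid and a function $f(s,\eta)$ such that $$\rho J=f(s,\eta)\ \operatorname{grad}s\wedge\operatorname{grad}\eta,\qquad \frac{d\eta}{dt}=0 .$$ Precisely: for all $t_0\in I$ and $X_0\in\mathcal D_0$ with $\operatorname{grad}s(t_0,\varphi_{t_0}(X_0))\ne0$ there are an open set $O$ with $X_0\in O\subseteq\mathcal D_0$, a $C^k$ function $\eta$ on $\mathcal W_O=\{(t,\varphi_t(X)):t\in I,\ X\in O\}$ and a $C^k$ function $f:\mathbb R^2\to\mathbb R$ such that $d\eta/dt=0$ and $\rho J=f(s,\eta)\,\operatorname{grad}s\wedge\operatorname{grad}\eta$ on $\mathcal W_O$. Here $\operatorname{grad}$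 and $\operatorname{div}$ are taken in $x$ at fixed $t$, and $\wedge$ is the vector product of $\mathbb R^3$. -/

import Mathlib

open Set
open scoped Gradient

noncomputable section

/-- Physical space `ℝ³` with its Euclidean structure. -/
abbrev Space3 : Type := EuclideanSpace ℝ (Fin 3)

/-- The vector product of two vectors of `ℝ³`. -/
def cross3 (a b : Space3) : Space3 :=
  WithLp.toLp 2 (crossProduct a.ofLp b.ofLp)

/-- The divergence `∑ i, ∂vᵢ/∂xᵢ` of a vector field on `ℝ³`. -/
def div3 (v : Space3 → Space3) (x : Space3) : ℝ :=
  ∑ i : Fin 3, (fderiv ℝ v x (EuclideanSpace.single i 1)) i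

/-- A fluid motion of class `C^r`: a family of maps `x = φ t X` from a reference domain `D₀`,
for `t` in an open time interval, of class `C^r` in `(t, X)`.
Each `φ t` is a `C^r` diffeomorphism of `D₀` onto its (open) image; by the inverse function
theorem this is injectivity together with invertibility of the tangent map. -/
structure FluidMotion (r : WithTop ℕ∞) where
  time : Set ℝ
  isOpen_time : IsOpen time
  ordConnected_time : time.OrdConnected
  D₀ : Set Space3
  isOpen_D₀ : IsOpen D₀
  φ : ℝ → Space3 → Space3
  contDiffOn_φ : ContDiffOn ℝ r (fun Z : ℝ × Space3 => φ Z.1 Z.2) (time ×ˢ D₀)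
  injOn_φ : ∀ t ∈ time, InjOn (φ t) D₀
  isInvertible_fderiv : ∀ t ∈ time, ∀ X ∈ D₀, (fderiv ℝ (φ t) X).IsInvertible

namespace FluidMotion

variable {r : WithTop ℕ∞} (M : FluidMotion r)

/-- The part of space-time swept by the particles of `O ⊆ D₀`. -/
def tube (O : Set Space3) : Set (ℝ × Space3) :=
  {z | z.1 ∈ M.time ∧ ∃ X ∈ O, M.φ z.1 X = z.2}

/-- The space-time domain of the motion. -/
def spaceTime : Set (ℝ × Space3) := M.tube M.D₀

/-- The tangent map `F = ∂x/∂X` of `φ t` at `X`. -/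
def F (t : ℝ) (X : Space3) : Space3 →L[ℝ] Space3 := fderiv ℝ (M.φ t) X

/-! The Lie derivative along the space-time velocity `(1, u)` of a time-dependent tensor field
on the moving domain, evaluated at the space-time point `(t, φ t X)`: the field is pulled back
to the reference space along the trajectory of `X`, differentiated in time there, and the
result is pushed forward to `(t, φ t X)`. -/

/-- Lie derivative of a scalar field: its material derivative. -/
def lieScalar (s : ℝ → Space3 → ℝ) (t : ℝ) (X : Space3) : ℝ :=
  deriv (fun τ => s τ (M.φ τ X)) t

/-- Lie derivative of a vector field. Its image in the reference space is `F⁻¹ J`. -/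
def lieVector (J : ℝ → Space3 → Space3) (t : ℝ) (X : Space3) : Space3 :=
  M.F t X (deriv (fun τ => (M.F τ X).inverse (J τ (M.φ τ X))) t)

/-- Lie derivative of the `3`-form `ρ det`, as the scalar coefficient of `det`. The image of
`ρ det` in the reference space has the coefficient `ρ det F`. -/
def lieThreeForm (ρ : ℝ → Space3 → ℝ) (t : ℝ) (X : Space3) : ℝ :=
  (M.F t X).det⁻¹ * deriv (fun τ => ρ τ (M.φ τ X) * (M.F τ X).det) t

/-- A scalar field defined on the space-time tube of `O` moves with the fluid there. -/
def ScalarMoves (O : Set Space3) (s : ℝ → Space3 → ℝ) : Prop :=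
  ∀ t ∈ M.time, ∀ X ∈ O, M.lieScalar s t X = 0

/-- A vector field moves with the fluid. -/
def VectorMoves (O : Set Space3) (J : ℝ → Space3 → Space3) : Prop :=
  ∀ t ∈ M.time, ∀ X ∈ O, M.lieVector J t X = 0

/-- The `3`-form `ρ det` moves with the fluid. -/
def ThreeFormMoves (O : Set Space3) (ρ : ℝ → Space3 → ℝ) : Prop :=
  ∀ t ∈ M.time, ∀ X ∈ O, M.lieThreeForm ρ t X = 0

end FluidMotion

end

/-! The field `ρ J` is found in the form grad s × grad η at the single time `t₀`, and the flow
carries the identity to all other times. At time `t₀`, `v = ρ J` is divergence-free and tangent to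
the level surfaces of `s`. Contracting the area form of these surfaces (the one that volume and `ds`
determine) with `v` gives a 1-form on each of them, closed because `div v = 0`. A Poincaré lemma
with the level as a smooth parameter (`exists_leafwise_potential`) gives a potential `η₀`, and `v =
grad s × grad η₀` follows (`exists_clebsch_potential`). The field `η` is `η₀` transported along
trajectories, so `dη/dt = 0`. In the reference space, `ρ det F` and `F⁻¹ J` are constant in time
because their Lie derivatives vanish; `s` and `η` are constant there too. As `det F` times the
vector product of two gradients is `F` applied to the vector product of their pullbacks, the
identity at `t₀` holds at every time (`flux_eq_of_pullback_eq`). The freedom in `η₀` absorbs the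
factor `f`, so `f = 1`. -/

section FluidMotionProof

open Topology Filter

universe u

/-! ### Smoothness of integrals depending on a parameter. -/

section ParametricIntegral

variable {E : Type*} [NormedAddCommGroup E] [NormedSpace ℝ E] [FiniteDimensional ℝ E]

theorem hasFDerivAt_intervalIntegral_of_contDiff {F : Type*} [NormedAddCommGroup F]
    [NormedSpace ℝ F] [CompleteSpace F] {f : E × ℝ → F} (hf : ContDiff ℝ 1 f) (a b : ℝ) (x : E) :
    HasFDerivAt (fun x => ∫ t in a..b, f (x, t))
      (∫ t in a..b, (fderiv ℝ f (x, t)).comp (ContinuousLinearMap.inl ℝ E ℝ)) x := by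
  have hcont : Continuous fun p : E × ℝ => (fderiv ℝ f p).comp (ContinuousLinearMap.inl ℝ E ℝ) :=
    (hf.continuous_fderiv one_ne_zero).clm_comp continuous_const
  obtain ⟨C, hC⟩ := ((isCompact_closedBall x 1).prod (isCompact_uIcc (a := a) (b :=
    b))).exists_bound_of_continuousOn hcont.continuousOn
  refine intervalIntegral.hasFDerivAt_integral_of_dominated_of_fderiv_le
    (F := fun x t => f (x, t))
    (F' := fun x t => (fderiv ℝ f (x, t)).comp (ContinuousLinearMap.inl ℝ E ℝ))
    (bound := fun _ => C) (Metric.closedBall_mem_nhds x one_pos) ?_ ?_ ?_ ?_ ?_ ?_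
  · exact Eventually.of_forall fun y =>
      (hf.continuous.comp (Continuous.prodMk_right y)).aestronglyMeasurable
  · exact (hf.continuous.comp (Continuous.prodMk_right x)).intervalIntegrable _ _
  · exact (hcont.comp (Continuous.prodMk_right x)).aestronglyMeasurable
  · exact Eventually.of_forall fun t ht y hy => hC (y, t) ⟨hy, uIoc_subset_uIcc ht⟩
  · exact intervalIntegrable_const
  · refine Eventually.of_forall fun t _ y _ => ?_
    exact (hf.differentiable one_ne_zero (y, t)).hasFDerivAt.comp y (hasFDerivAt_prodMk_left y t)

/-- Each differentiation replaces `F` by `E →L[ℝ] F`. Hence the induction quantifies over `F`, and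
`E` and `F` share a universe so that the new target is again admissible. -/
theorem contDiff_intervalIntegral_nat {E : Type u} [NormedAddCommGroup E] [NormedSpace ℝ E]
    [FiniteDimensional ℝ E] (n : ℕ) (a b : ℝ) :
    ∀ {F : Type u} [NormedAddCommGroup F] [NormedSpace ℝ F] [CompleteSpace F] {f : E × ℝ → F},
      ContDiff ℝ n f → ContDiff ℝ n fun x => ∫ t in a..b, f (x, t) := by
  induction n with
  | zero =>
    intro F _ _ _ f hf
    rw [Nat.cast_zero, contDiff_zero] at hf ⊢
    exact intervalIntegral.continuous_parametric_intervalIntegral_of_continuous'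
      (f := fun x t => f (x, t)) hf a b
  | succ n ih =>
    intro F _ _ _ f hf
    have hf' := hf
    push_cast at hf ⊢
    rw [contDiff_succ_iff_fderiv] at hf
    have h1 : ContDiff ℝ 1 f := hf'.of_le (by exact_mod_cast Nat.le_add_left 1 n)
    have hd := hasFDerivAt_intervalIntegral_of_contDiff h1 a b
    rw [contDiff_succ_iff_fderiv]
    refine ⟨fun x => (hd x).differentiableAt, by simp, ?_⟩
    rw [show fderiv ℝ (fun x => ∫ t in a..b, f (x, t)) = _ from funext fun x => (hd x).fderiv]
    exact ih (f := fun p => (fderiv ℝ f p).comp (ContinuousLinearMap.inl ℝ E ℝ))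
      (hf.2.2.clm_comp contDiff_const)

theorem contDiff_intervalIntegral {E F : Type u} [NormedAddCommGroup E] [NormedSpace ℝ E]
    [FiniteDimensional ℝ E] [NormedAddCommGroup F] [NormedSpace ℝ F] [CompleteSpace F]
    {k : ℕ∞} {f : E × ℝ → F} (hf : ContDiff ℝ k f) (a b : ℝ) :
    ContDiff ℝ k fun x => ∫ t in a..b, f (x, t) := by
  rw [contDiff_iff_forall_nat_le] at hf ⊢
  exact fun m hm => contDiff_intervalIntegral_nat m a b (hf m hm)

end ParametricIntegral

/-! ### Potentials along parallel affine subspaces. -/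

section LeafwisePotential

variable {E : Type} [NormedAddCommGroup E] [NormedSpace ℝ E] [FiniteDimensional ℝ E]

/-- The point at parameter `p.2` of the segment from the foot of the perpendicular `x - P (x - c)`
to `x = p.1`. -/
def leafSegment (P : E →L[ℝ] E) (c : E) (p : E × ℝ) : E := p.1 + (p.2 - 1) • P (p.1 - c)

/-- The integral of the `1`-form `β` along the segments parallel to the range of the
projection `P`. -/
noncomputable def leafPotential (P : E →L[ℝ] E) (c : E) (β : E → E →L[ℝ] ℝ) (x : E) : ℝ :=
  ∫ t in (0 : ℝ)..1, β (leafSegment P c (x, t)) (P (x - c))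

omit [FiniteDimensional ℝ E] in
theorem contDiff_leafSegment (P : E →L[ℝ] E) (c : E) {n : WithTop ℕ∞} :
    ContDiff ℝ n (leafSegment P c) := by
  unfold leafSegment; fun_prop

omit [FiniteDimensional ℝ E] in
theorem contDiff_leafIntegrand (P : E →L[ℝ] E) (c : E) {k : WithTop ℕ∞} {β : E → E →L[ℝ] ℝ}
    (hβ : ContDiff ℝ k β) :
    ContDiff ℝ k fun p : E × ℝ => β (leafSegment P c p) (P (p.1 - c)) :=
  (hβ.comp (contDiff_leafSegment P c)).clm_apply (by fun_prop)

theorem contDiff_leafPotential (P : E →L[ℝ] E) (c : E) {k : ℕ∞} {β : E → E →L[ℝ] ℝ}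
    (hβ : ContDiff ℝ k β) : ContDiff ℝ k (leafPotential P c β) :=
  contDiff_intervalIntegral (contDiff_leafIntegrand P c hβ) 0 1

/-- As in the usual Poincaré lemma, for `w` in the range of `P` the symmetry of `fderiv ℝ β` turns
the `w`-derivative of the integrand into `d/dt (t * β w)`, evaluated along the segment. Only
directions in the range of `P` enter, so closedness along the leaves suffices. -/
theorem fderiv_leafPotential (P : E →L[ℝ] E) (c : E) {β : E → E →L[ℝ] ℝ}
    (hβ : ContDiff ℝ 1 β) (hP : ∀ y, P (P y) = P y) (x : E)
    (hsymm : ∀ t ∈ Icc (0 : ℝ) 1, ∀ v w, P v = v → P w = w →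
      fderiv ℝ β (leafSegment P c (x, t)) v w = fderiv ℝ β (leafSegment P c (x, t)) w v)
    (w : E) (hw : P w = w) : fderiv ℝ (leafPotential P c β) x w = β x w := by
  have hint := contDiff_leafIntegrand P c hβ
  have hd := hasFDerivAt_intervalIntegral_of_contDiff hint 0 1 x
  have hcont : Continuous fun t : ℝ => (fderiv ℝ (fun p : E × ℝ =>
      β (leafSegment P c p) (P (p.1 - c))) (x, t)).comp (ContinuousLinearMap.inl ℝ E ℝ) :=
    ((hint.continuous_fderiv one_ne_zero).comp (Continuous.prodMk_right x)).clm_comp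
      continuous_const
  rw [show fderiv ℝ (leafPotential P c β) x = _ from hd.fderiv,
    ContinuousLinearMap.intervalIntegral_apply (hcont.intervalIntegrable 0 1)]
  have hseg (t : ℝ) : HasFDerivAt (fun y => leafSegment P c (y, t))
      (ContinuousLinearMap.id ℝ E + (t - 1) • P) x := by
    have h1 : HasFDerivAt (fun y => P (y - c)) P x := by
      exact P.hasFDerivAt.comp x ((hasFDerivAt_id x).sub_const c)
    exact (hasFDerivAt_id x).add (h1.const_smul (t - 1))
  have hβd (y : E) : HasFDerivAt β (fderiv ℝ β y) y :=
    (hβ.differentiable one_ne_zero y).hasFDerivAt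
  have key : ∀ t ∈ uIcc (0 : ℝ) 1, HasDerivAt (fun t => t * β (leafSegment P c (x, t)) w)
      (((fderiv ℝ (fun p : E × ℝ => β (leafSegment P c p) (P (p.1 - c))) (x, t)).comp
        (ContinuousLinearMap.inl ℝ E ℝ)) w) t := by
    intro t ht
    rw [uIcc_of_le zero_le_one] at ht
    have hA : HasFDerivAt (fun y => β (leafSegment P c (y, t)) (P (y - c))) _ x :=
      ((hβd _).comp x (hseg t)).clm_apply (P.hasFDerivAt.comp x ((hasFDerivAt_id x).sub_const c))
    have hB : HasFDerivAt (fun y => β (leafSegment P c (y, t)) (P (y - c)))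
        ((fderiv ℝ (fun p : E × ℝ => β (leafSegment P c p) (P (p.1 - c))) (x, t)).comp
          (ContinuousLinearMap.inl ℝ E ℝ)) x :=
      (hint.differentiable one_ne_zero (x, t)).hasFDerivAt.comp (f := fun y => (y, t)) x
        (hasFDerivAt_prodMk_left x t)
    rw [hB.unique hA]
    have hline : HasDerivAt (fun t => leafSegment P c (x, t)) (P (x - c)) t := by
      unfold leafSegment
      simpa using (((hasDerivAt_id t).sub_const 1).smul_const (P (x - c))).const_add x
    have h2 := ((hβd _).comp_hasDerivAt t hline).clm_apply (hasDerivAt_const t w)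
    have h3 : HasDerivAt (fun t => t * β (leafSegment P c (x, t)) w) _ t := (hasDerivAt_id t).mul h2
    refine h3.congr_deriv ?_
    have := hsymm t ht w (P (x - c)) hw (hP _)
    simp only [id, add_apply, ContinuousLinearMap.comp_apply,
      ContinuousLinearMap.flip_apply, ContinuousLinearMap.id_apply, map_zero, add_zero, one_mul,
      Function.comp_apply, smul_apply, hw, ← this]
    rw [show w + (t - 1) • w = t • w by module]
    simp
  rw [intervalIntegral.integral_eq_sub_of_hasDerivAt key]
  · simp [leafSegment]
  · exact ((hcont.clm_apply continuous_const).intervalIntegrable 0 1)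

end LeafwisePotential

/-! ### The Poincaré lemma along the level surfaces of a function. -/

section LeafwisePoincare

variable {E : Type} [NormedAddCommGroup E] [NormedSpace ℝ E] [FiniteDimensional ℝ E]

theorem ContDiffOn.exists_contDiff_eqOn_ball {F : Type*} [NormedAddCommGroup F] [NormedSpace ℝ F]
    {k : ℕ∞} {T : Set E} {β : E → F} {y₀ : E} (hβ : ContDiffOn ℝ k β T) (hT : T ∈ 𝓝 y₀) :
    ∃ (β' : E → F) (r : ℝ), 0 < r ∧ Metric.ball y₀ r ⊆ T ∧ ContDiff ℝ k β' ∧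
      EqOn β' β (Metric.ball y₀ r) := by
  obtain ⟨R, hR, hRT⟩ := Metric.mem_nhds_iff.1 hT
  let χ : ContDiffBump y₀ := ⟨R / 4, R / 2, by positivity, by linarith⟩
  have hsub : Metric.closedBall y₀ (R / 2) ⊆ Metric.ball y₀ R :=
    Metric.closedBall_subset_ball (by linarith)
  refine ⟨fun y => χ y • β y, R / 4, by positivity,
    (Metric.ball_subset_ball (by linarith)).trans hRT, ?_, ?_⟩
  · rw [contDiff_iff_contDiffAt]
    intro y
    by_cases hy : y ∈ Metric.closedBall y₀ (R / 2)
    · exact χ.contDiffAt.smul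
        (hβ.contDiffAt (mem_of_superset (Metric.isOpen_ball.mem_nhds (hsub hy)) hRT))
    · have h0 : (fun y => χ y • β y) =ᶠ[𝓝 y] fun _ => 0 := by
        filter_upwards [Metric.isClosed_closedBall.isOpen_compl.mem_nhds hy] with z hz
        have : χ z = 0 := χ.zero_of_le_dist (by simpa using le_of_lt (by simpa using hz))
        simp [this]
      exact contDiffAt_const.congr_of_eventuallyEq h0
  · intro y hy
    have : χ y = 1 := χ.one_of_mem_closedBall (Metric.ball_subset_closedBall hy)
    simp [this]

/-- **Leafwise Poincaré lemma.** A `1`-form which is closed along the level surfaces of `s`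
is, locally near a regular point of `s`, exact along these level surfaces. -/
theorem exists_leafwise_potential {k : ℕ∞} (hk : 1 ≤ k) {U : Set E} (hU : IsOpen U) {x₀ e : E}
    (hx₀ : x₀ ∈ U) {s : E → ℝ} (hs : ContDiffOn ℝ k s U) (he : fderiv ℝ s x₀ e ≠ 0)
    {α : E → E →L[ℝ] ℝ} (hα : ContDiffOn ℝ k α U) (hαe : ∀ x ∈ U, α x e = 0)
    (hclosed : ∀ x ∈ U, ∀ v w, fderiv ℝ s x v = 0 → fderiv ℝ s x w = 0 →
      fderiv ℝ α x v w = fderiv ℝ α x w v) :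
    ∃ V ⊆ U, IsOpen V ∧ x₀ ∈ V ∧ ∃ η : E → ℝ, ContDiffOn ℝ k η V ∧
      ∀ x ∈ V, ∀ w, fderiv ℝ s x w = 0 → fderiv ℝ η x w = α x w := by
  have hk0 : (k : WithTop ℕ∞) ≠ 0 := by
    have : (1 : WithTop ℕ∞) ≤ k := by exact_mod_cast hk
    exact (zero_lt_one.trans_le this).ne'
  have hk1 : (1 : WithTop ℕ∞) ≤ k := by exact_mod_cast hk
  set g := fderiv ℝ s x₀ e with hg
  set l : E →L[ℝ] ℝ := g⁻¹ • fderiv ℝ s x₀ with hl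
  have hle : l e = 1 := by simp [hl, ← hg, he]
  set P : E →L[ℝ] E := ContinuousLinearMap.id ℝ E - l.smulRight e with hPdef
  have hPapply (w : E) : P w = w - l w • e := by simp [hPdef]
  have hlP (w : E) (hw : P w = w) : l w = 0 := by
    have h1 := congrArg l hw
    rw [hPapply, map_sub, map_smul, hle] at h1
    simpa using h1.symm
  have hPP (w : E) : P (P w) = P w := by
    simp [hPapply, hle]
  -- `Φ` moves points along `e` only and satisfies `l (Φ x) = g⁻¹ * s x`: it straightens the level
  -- surfaces of `s` into the hyperplanes `l = const`, with derivative the identity at `x₀`.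
  set Φ : E → E := fun x => x + (g⁻¹ * s x - l x) • e with hΦ
  have hΦc : ContDiffOn ℝ k Φ U :=
    contDiffOn_id.add (((contDiffOn_const.mul hs).sub l.contDiff.contDiffOn).smul contDiffOn_const)
  have hΦd : ∀ x ∈ U, HasFDerivAt Φ
      (ContinuousLinearMap.id ℝ E + (g⁻¹ • fderiv ℝ s x - l).smulRight e) x := by
    intro x hx
    have h1 : HasFDerivAt s (fderiv ℝ s x) x :=
      ((hs.contDiffAt (hU.mem_nhds hx)).differentiableAt hk0).hasFDerivAt
    exact (hasFDerivAt_id x).add (((h1.const_mul g⁻¹).sub l.hasFDerivAt).smul_const e)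
  have hΦat : ∀ x ∈ U, ContDiffAt ℝ k Φ x := fun x hx => hΦc.contDiffAt (hU.mem_nhds hx)
  have hΦ0 : HasFDerivAt Φ ((ContinuousLinearEquiv.refl ℝ E : E ≃L[ℝ] E) : E →L[ℝ] E) x₀ := by
    convert hΦd x₀ hx₀ using 1
    ext w
    simp [hl]
  let h := (hΦat x₀ hx₀).toOpenPartialHomeomorph Φ hΦ0 hk0
  have hcoe : (h : E → E) = Φ := rfl
  have hx₀s : x₀ ∈ h.source := (hΦat x₀ hx₀).mem_toOpenPartialHomeomorph_source hΦ0 hk0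
  set U' : Set E := U ∩ fderiv ℝ Φ ⁻¹' range ((↑) : (E ≃L[ℝ] E) → E →L[ℝ] E) with hU'
  have hU'o : IsOpen U' :=
    (hΦc.continuousOn_fderiv_of_isOpen hU hk1).isOpen_inter_preimage hU ContinuousLinearEquiv.isOpen
  have hx₀' : x₀ ∈ U' := ⟨hx₀, ⟨_, hΦ0.fderiv.symm⟩⟩
  set T : Set E := h.target ∩ h.symm ⁻¹' U' with hT
  have hTo : IsOpen T := h.isOpen_inter_preimage_symm hU'o
  have hsymmx : h.symm (Φ x₀) = x₀ := h.left_inv hx₀s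
  have hy₀ : Φ x₀ ∈ T := ⟨h.map_source hx₀s, by rw [mem_preimage, hsymmx]; exact hx₀'⟩
  have hsymmc : ∀ y ∈ T, ContDiffAt ℝ k h.symm y := by
    intro y hy
    obtain ⟨A, hA⟩ := hy.2.2
    refine h.contDiffAt_symm hy.1 (f₀' := A) ?_ (hΦat _ hy.2.1)
    rw [hA]
    exact (hΦd _ hy.2.1).differentiableAt.hasFDerivAt
  -- Composition with `h.symm` suffices, without its derivative acting on the argument of the form:
  -- on `ker ds` the derivative of `Φ` is `P`, which changes vectors by multiples of `e`, and `α`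
  -- kills `e`.
  have hβ₀ : ContDiffOn ℝ k (fun y => α (h.symm y)) T := fun y hy =>
    ((hα.contDiffAt (hU.mem_nhds hy.2.1)).comp y (hsymmc y hy)).contDiffWithinAt
  obtain ⟨β, r, hr, hrT, hβ, hββ₀⟩ := hβ₀.exists_contDiff_eqOn_ball (hTo.mem_nhds hy₀)
  set B := Metric.ball (Φ x₀) r with hB
  -- Both the point and the foot of its segment lie in the ball, so by convexity the whole segment
  -- does, and there `β` is the original form rather than its cut-off extension.
  set B' : Set E := B ∩ (fun y => y - P (y - Φ x₀)) ⁻¹' B with hB'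
  have hB'o : IsOpen B' := Metric.isOpen_ball.inter (Metric.isOpen_ball.preimage (by fun_prop))
  have hy₀B : Φ x₀ ∈ B' := ⟨Metric.mem_ball_self hr, by simp [hB, hr]⟩
  refine ⟨h.source ∩ Φ ⁻¹' B' ∩ U, inter_subset_right,
    (h.isOpen_inter_preimage hB'o).inter hU, ⟨⟨hx₀s, hy₀B⟩, hx₀⟩,
    fun x => leafPotential P (Φ x₀) β (Φ x),
    (contDiff_leafPotential P (Φ x₀) hβ).comp_contDiffOn (hΦc.mono inter_subset_right), ?_⟩
  rintro x ⟨⟨hxs, hxB⟩, hxU⟩ w hw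
  have hψ : DifferentiableAt ℝ (leafPotential P (Φ x₀) β) (Φ x) :=
    (contDiff_leafPotential P (Φ x₀) hβ).differentiable hk0 _
  have hη : HasFDerivAt (fun x => leafPotential P (Φ x₀) β (Φ x)) _ x :=
    hψ.hasFDerivAt.comp x (hΦd x hxU)
  have hPw : (ContinuousLinearMap.id ℝ E + (g⁻¹ • fderiv ℝ s x - l).smulRight e) w = P w := by
    simp [hPapply, hw, sub_eq_add_neg]
  rw [hη.fderiv, ContinuousLinearMap.comp_apply, hPw,
    fderiv_leafPotential P (Φ x₀) (hβ.of_le hk1) hPP (Φ x) ?_ _ (hPP w), hββ₀ hxB.1]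
  · have : h.symm (Φ x) = x := h.left_inv hxs
    simp only [this, hPapply, map_sub, map_smul, hαe x hxU, smul_zero, sub_zero]
  intro t ht v w hv hw
  set y := leafSegment P (Φ x₀) (Φ x, t) with hy
  have hyB : y ∈ B := by
    have h1 := (convex_ball (Φ x₀) r) hxB.1 hxB.2 ht.1 (sub_nonneg.2 ht.2) (by ring)
    convert h1 using 1
    simp only [hy, leafSegment]
    module
  have hyT := hrT hyB
  have hαd : HasFDerivAt α (fderiv ℝ α (h.symm y)) (h.symm y) :=
    ((hα.contDiffAt (hU.mem_nhds hyT.2.1)).differentiableAt hk0).hasFDerivAt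
  have hsd := ((hsymmc y hyT).differentiableAt hk0).hasFDerivAt
  have hβd : fderiv ℝ β y = (fderiv ℝ α (h.symm y)).comp (fderiv ℝ h.symm y) := by
    rw [(hββ₀.eventuallyEq_of_mem (Metric.isOpen_ball.mem_nhds hyB)).fderiv_eq]
    exact (hαd.comp y hsd).fderiv
  have hinv : ∀ v, P v = v → fderiv ℝ s (h.symm y) (fderiv ℝ h.symm y v) = 0 ∧
      v = fderiv ℝ h.symm y v - l (fderiv ℝ h.symm y v) • e := by
    intro v hv
    have hΦy := hΦd _ hyT.2.1
    have hid : HasFDerivAt (fun z => Φ (h.symm z)) _ y := hΦy.comp y hsd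
    have hid' : HasFDerivAt (fun z => Φ (h.symm z)) (ContinuousLinearMap.id ℝ E) y :=
      (hasFDerivAt_id y).congr_of_eventuallyEq
        (Filter.mem_of_superset (h.open_target.mem_nhds hyT.1) fun z hz => h.right_inv hz)
    have h1 := congrArg (fun A : E →L[ℝ] E => A v) (hid.unique hid')
    set u := fderiv ℝ h.symm y v
    replace h1 : u + (g⁻¹ * fderiv ℝ s (h.symm y) u - l u) • e = v := by simpa using h1
    have h2 := congrArg l h1
    rw [map_add, map_smul, hle, hlP v hv] at h2
    have h3 : g⁻¹ * fderiv ℝ s (h.symm y) u = 0 := by simpa using h2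
    refine ⟨(mul_eq_zero.1 h3).resolve_left (inv_ne_zero he), ?_⟩
    rw [← h1, h3]
    module
  have hαe' (u : E) : fderiv ℝ α (h.symm y) u e = 0 := by
    have h1 := hαd.clm_apply (hasFDerivAt_const e (h.symm y))
    have h2 : HasFDerivAt (fun x => α x e) (0 : E →L[ℝ] ℝ) (h.symm y) :=
      (hasFDerivAt_const (0 : ℝ) _).congr_of_eventuallyEq
        (Filter.mem_of_superset (hU.mem_nhds hyT.2.1) hαe)
    simpa using congrArg (fun A : E →L[ℝ] ℝ => A u) (h1.unique h2)
  obtain ⟨hv1, hv2⟩ := hinv v hv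
  obtain ⟨hw1, hw2⟩ := hinv w hw
  have hc := hclosed _ hyT.2.1 _ _ hv1 hw1
  rw [hβd, ContinuousLinearMap.comp_apply, ContinuousLinearMap.comp_apply]
  conv_lhs => rw [show fderiv ℝ α (h.symm y) (fderiv ℝ h.symm y v) w =
    fderiv ℝ α (h.symm y) (fderiv ℝ h.symm y v) (fderiv ℝ h.symm y w -
      l (fderiv ℝ h.symm y w) • e) by rw [← hw2]]
  conv_rhs => rw [show fderiv ℝ α (h.symm y) (fderiv ℝ h.symm y w) v =
    fderiv ℝ α (h.symm y) (fderiv ℝ h.symm y w) (fderiv ℝ h.symm y v -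
      l (fderiv ℝ h.symm y v) • e) by rw [← hv2]]
  simp [map_sub, hαe', hc]

end LeafwisePoincare

/-! ### Vector algebra of `ℝ³`. -/

section CrossProduct

theorem inner_space3 (a b : Space3) : inner ℝ a b = a 0 * b 0 + a 1 * b 1 + a 2 * b 2 := by
  simp [PiLp.inner_apply, Fin.sum_univ_three, mul_comm]

@[simp] theorem cross3_zero (a b : Space3) : cross3 a b 0 = a 1 * b 2 - a 2 * b 1 := by
  simp [cross3, cross_apply]

@[simp] theorem cross3_one (a b : Space3) : cross3 a b 1 = a 2 * b 0 - a 0 * b 2 := by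
  simp [cross3, cross_apply]

@[simp] theorem cross3_two (a b : Space3) : cross3 a b 2 = a 0 * b 1 - a 1 * b 0 := by
  simp [cross3, cross_apply]

theorem space3_eq_sum (a : Space3) : a = a 0 • EuclideanSpace.single 0 1 +
    a 1 • EuclideanSpace.single 1 1 + a 2 • EuclideanSpace.single 2 1 := by
  ext i
  fin_cases i <;> simp

theorem inner_cross3_cross3 (a b c d : Space3) : inner ℝ (cross3 a b) (cross3 c d) =
    inner ℝ a c * inner ℝ b d - inner ℝ a d * inner ℝ b c := by
  simp only [inner_space3, cross3_zero, cross3_one, cross3_two]; ring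

theorem inner_cross3_rotate (a b c : Space3) :
    inner ℝ (cross3 a b) c = inner ℝ b (cross3 c a) := by
  simp only [inner_space3, cross3_zero, cross3_one, cross3_two]; ring

theorem inner_cross3_swap (a b c : Space3) :
    inner ℝ (cross3 a b) c = -inner ℝ (cross3 a c) b := by
  simp only [inner_space3, cross3_zero, cross3_one, cross3_two]; ring

theorem clm_apply_space3 (N : Space3 →L[ℝ] ℝ) (a : Space3) :
    N a = a 0 * N (EuclideanSpace.single 0 1) + a 1 * N (EuclideanSpace.single 1 1) +
      a 2 * N (EuclideanSpace.single 2 1) := by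
  conv_lhs => rw [space3_eq_sum a]
  simp

/-- Cramer's rule for four vectors of `ℝ³`. -/
theorem cramer_space3 (N : Space3 →L[ℝ] ℝ) (a b c d : Space3) :
    inner ℝ (cross3 b c) d * N a - inner ℝ (cross3 a c) d * N b + inner ℝ (cross3 a b) d * N c
      - inner ℝ (cross3 a b) c * N d = 0 := by
  rw [clm_apply_space3 N a, clm_apply_space3 N b, clm_apply_space3 N c, clm_apply_space3 N d]
  simp only [inner_space3, cross3_zero, cross3_one, cross3_two]; ring

theorem clm_apply_coord_space3 (D : Space3 →L[ℝ] Space3) (a : Space3) (i : Fin 3) :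
    D a i = a 0 * D (EuclideanSpace.single 0 1) i + a 1 * D (EuclideanSpace.single 1 1) i +
      a 2 * D (EuclideanSpace.single 2 1) i := by
  conv_lhs => rw [space3_eq_sum a]
  simp

theorem sum_inner_cross3_eq_trace_mul (D : Space3 →L[ℝ] Space3) (a b c : Space3) :
    inner ℝ (cross3 (D a) b) c + inner ℝ (cross3 a (D b)) c + inner ℝ (cross3 a b) (D c) =
      (∑ i : Fin 3, D (EuclideanSpace.single i 1) i) * inner ℝ (cross3 a b) c := by
  simp only [inner_space3, cross3_zero, cross3_one, cross3_two, Fin.sum_univ_three,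
    clm_apply_coord_space3 D a, clm_apply_coord_space3 D b, clm_apply_coord_space3 D c]
  ring

/-- `b ↦ a × b` as a continuous linear map. -/
noncomputable def cross3L (a : Space3) : Space3 →L[ℝ] Space3 :=
  LinearMap.toContinuousLinearMap
    { toFun := cross3 a
      map_add' := fun b c => by simp [cross3]
      map_smul' := fun r b => by simp [cross3] }

@[simp] theorem cross3L_apply (a b : Space3) : cross3L a b = cross3 a b := rfl

theorem inner_gradient_space3 (f : Space3 → ℝ) (x w : Space3) :
    inner ℝ (∇ f x) w = fderiv ℝ f x w := by
  rw [gradient, InnerProductSpace.toDual_symm_apply]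

end CrossProduct

/-! ### Divergence-free fields tangent to level surfaces. -/

section ClebschPotential

/-- The symmetry of the derivative of `-(∂ₑs)⁻¹ ⟨e × v, ·⟩` on the kernel of `N = ds`, where
`H` is the second derivative of `s` and `D` is the derivative of `v`. -/
theorem closed_along_kernel {N : Space3 →L[ℝ] ℝ} {D : Space3 →L[ℝ] Space3}
    {H : Space3 →L[ℝ] Space3 →L[ℝ] ℝ} (hH : ∀ a b, H a b = H b a) {e v : Space3} (he : N e ≠ 0)
    (htr : ∑ i : Fin 3, D (EuclideanSpace.single i 1) i = 0) (hNv : N v = 0)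
    (hHv : ∀ a, H a v + N (D a) = 0) {u w : Space3} (hu : N u = 0) (hw : N w = 0) :
    -(N e)⁻¹ * inner ℝ (cross3 e (D u)) w + ((N e) ^ 2)⁻¹ * H u e * inner ℝ (cross3 e v) w =
    -(N e)⁻¹ * inner ℝ (cross3 e (D w)) u + ((N e) ^ 2)⁻¹ * H w e * inner ℝ (cross3 e v) u := by
  -- The zero trace gives a relation between triple products with `D e`, `D u`, `D w`. Cramer's rule
  -- with `N` removes `D e`, and Cramer's rule with `H(·, e)` matches the terms from differentiating
  -- `(N e)⁻¹`. The product `⟨v × u, w⟩` vanishes since all three vectors lie in the plane `ker N`.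
  have h1 := sum_inner_cross3_eq_trace_mul D e u w
  rw [htr, zero_mul] at h1
  have h2 := cramer_space3 N e (D e) u w
  have h3 := cramer_space3 N e v u w
  have h4 := cramer_space3 (H.flip e) e v u w
  simp only [ContinuousLinearMap.flip_apply] at h4
  have h5 := inner_cross3_swap e (D w) u
  have h6 := hHv e
  rw [hu, hw] at h2
  rw [hu, hw, hNv] at h3
  have h7 : inner ℝ (cross3 v u) w = 0 := by
    have : inner ℝ (cross3 v u) w * N e = 0 := by linarith
    exact (mul_eq_zero.1 this).resolve_right he
  rw [h7, hH v e] at h4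
  rw [h5]
  field_simp
  linear_combination (-N e) * h1 + h2 + inner ℝ (cross3 e u) w * h6 + h4

/-- Pairing `n × m` with `c` equals pairing `m` with `c × n`, which is orthogonal to `n`; so the
values of `m` on that plane determine the product. -/
theorem eq_cross3_of_tangential {n m e v : Space3} (he : inner ℝ n e ≠ 0) (hv : inner ℝ n v = 0)
    (hm : ∀ w, inner ℝ n w = 0 → inner ℝ m w = -(inner ℝ n e)⁻¹ * inner ℝ (cross3 e v) w) :
    v = cross3 n m := by
  refine ext_inner_right ℝ fun c => ?_
  rw [inner_cross3_rotate, hm, inner_cross3_cross3, real_inner_comm n v, real_inner_comm n e, hv]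
  · field_simp
    ring
  · simp only [inner_space3, cross3_zero, cross3_one, cross3_two]; ring

/-- A divergence-free vector field `v` tangent to the level surfaces of `s` is, locally near a
regular point of `s`, of the form `grad s × grad η`: the stream functions of `v` on the level
surfaces, chosen smoothly in the level, form `η`, so no further factor `f (s, η)` is needed. -/
theorem exists_clebsch_potential {k : ℕ∞} (hk : 1 ≤ k) {U : Set Space3} (hU : IsOpen U)
    {x₀ : Space3} (hx₀ : x₀ ∈ U) {s : Space3 → ℝ}
    (hs : ContDiffOn ℝ ((k : WithTop ℕ∞) + 1) s U) {v : Space3 → Space3}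
    (hv : ContDiffOn ℝ k v U) (hsv : ∀ x ∈ U, fderiv ℝ s x (v x) = 0)
    (hdiv : ∀ x ∈ U, div3 v x = 0) (hgrad : ∇ s x₀ ≠ 0) :
    ∃ V ⊆ U, IsOpen V ∧ x₀ ∈ V ∧ ∃ η : Space3 → ℝ, ContDiffOn ℝ k η V ∧
      ∀ x ∈ V, v x = cross3 (∇ s x) (∇ η x) := by
  have hk1 : (1 : WithTop ℕ∞) ≤ k := by exact_mod_cast hk
  have hk0 : (k : WithTop ℕ∞) ≠ 0 := (zero_lt_one.trans_le hk1).ne'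
  set e := ∇ s x₀
  have he₀ : fderiv ℝ s x₀ e ≠ 0 := by
    rw [← inner_gradient_space3]
    exact inner_self_ne_zero.2 hgrad
  have hds : ContDiffOn ℝ k (fderiv ℝ s) U := hs.fderiv_of_isOpen hU le_rfl
  have hdse : ContDiffOn ℝ k (fun x => fderiv ℝ s x e) U := hds.clm_apply contDiffOn_const
  set U₁ : Set Space3 := U ∩ (fun x => fderiv ℝ s x e) ⁻¹' {0}ᶜ with hU₁
  have hU₁o : IsOpen U₁ := hdse.continuousOn.isOpen_inter_preimage hU isOpen_compl_singleton
  -- If `v = grad s × m`, then `e × v = (e · m) grad s - (e · grad s) m`, so this is the only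
  -- possible value of `m` on `ker ds`; it also vanishes on `e`.
  set α : Space3 → Space3 →L[ℝ] ℝ := fun x =>
    (-(fderiv ℝ s x e)⁻¹) • innerSL ℝ (cross3L e (v x)) with hα
  have hαc : ContDiffOn ℝ k α U₁ := by
    refine ContDiffOn.smul ((hdse.mono inter_subset_left).inv fun x hx => hx.2).neg ?_
    exact (innerSL ℝ).contDiff.comp_contDiffOn
      ((cross3L e).contDiff.comp_contDiffOn (hv.mono inter_subset_left))
  have hαe : ∀ x ∈ U₁, α x e = 0 := by
    intro x hx
    have : inner ℝ (cross3 e (v x)) e = 0 := by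
      simp only [inner_space3, cross3_zero, cross3_one, cross3_two]; ring
    simp [hα, this]
  have hclosed : ∀ x ∈ U₁, ∀ a b, fderiv ℝ s x a = 0 → fderiv ℝ s x b = 0 →
      fderiv ℝ α x a b = fderiv ℝ α x b a := by
    intro x hx a b ha hb
    have hxn := hU.mem_nhds hx.1
    have hsd : HasFDerivAt (fderiv ℝ s) (fderiv ℝ (fderiv ℝ s) x) x :=
      ((hds.contDiffAt hxn).differentiableAt hk0).hasFDerivAt
    have hvd : HasFDerivAt v (fderiv ℝ v x) x :=
      ((hv.contDiffAt hxn).differentiableAt hk0).hasFDerivAt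
    have hαd : HasFDerivAt α (fderiv ℝ α x) x :=
      ((hαc.contDiffAt (hU₁o.mem_nhds hx)).differentiableAt hk0).hasFDerivAt
    have hform (a b : Space3) : fderiv ℝ α x a b =
        -(fderiv ℝ s x e)⁻¹ * inner ℝ (cross3 e (fderiv ℝ v x a)) b +
          ((fderiv ℝ s x e) ^ 2)⁻¹ * fderiv ℝ (fderiv ℝ s) x a e *
            inner ℝ (cross3 e (v x)) b := by
      have hse := hsd.clm_apply (hasFDerivAt_const e x)
      have hinv := (hasDerivAt_inv (show fderiv ℝ s x e ≠ 0 from hx.2)).comp_hasFDerivAt x hse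
      have hcr := ((cross3L e).hasFDerivAt (x := v x)).comp x hvd
      have hin := ((innerSL ℝ (E := Space3)).hasFDerivAt (x := cross3L e (v x))).comp x hcr
      have hfull : HasFDerivAt α _ x := hinv.neg.smul hin
      rw [hfull.fderiv]
      simp
      exact Or.inl rfl
    rw [hform, hform]
    refine closed_along_kernel ?_ hx.2 (hdiv x hx.1) (hsv x hx.1) ?_ ha hb
    · have h2 : ContDiffAt ℝ 2 s x := (hs.contDiffAt hxn).of_le (by
        rw [← one_add_one_eq_two]; gcongr)
      exact fun a b => (h2.isSymmSndFDerivAt (by simp)).eq a b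
    · intro a
      have h1 := hsd.clm_apply hvd
      have h2 : HasFDerivAt (fun y => fderiv ℝ s y (v y)) (0 : Space3 →L[ℝ] ℝ) x :=
        (hasFDerivAt_const (0 : ℝ) _).congr_of_eventuallyEq (Filter.mem_of_superset hxn hsv)
      have h3 := congrArg (fun A : Space3 →L[ℝ] ℝ => A a) (h1.unique h2)
      simpa [add_comm] using h3
  obtain ⟨V, hVU, hVo, hxV, η, hη, hηα⟩ := exists_leafwise_potential hk hU₁o (x₀ := x₀) (e := e)
    ⟨hx₀, he₀⟩ ((hs.of_le (by exact le_self_add)).mono inter_subset_left) he₀ hαc hαe hclosed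
  refine ⟨V, hVU.trans inter_subset_left, hVo, hxV, η, hη, fun x hx => ?_⟩
  have hxU := hVU hx
  refine eq_cross3_of_tangential (e := e) ?_ ?_ fun w hw => ?_
  · rw [inner_gradient_space3]; exact hxU.2
  · rw [inner_gradient_space3]; exact hsv x hxU.1
  · rw [inner_gradient_space3] at hw
    rw [inner_gradient_space3, inner_gradient_space3, hηα x hx w hw]
    simp [hα]

end ClebschPotential

/-! ### Consequences of the inverse function theorem. -/

section LeftInverse

variable {E F : Type*} [NormedAddCommGroup E] [NormedSpace ℝ E] [CompleteSpace E]
  [NormedAddCommGroup F] [NormedSpace ℝ F]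

theorem ContDiffAt.image_mem_nhds_of_equiv {n : WithTop ℕ∞} (hn : n ≠ 0) {Φ : E → F} {a : E}
    {S : Set E} (hS : S ∈ 𝓝 a) (hΦ : ContDiffAt ℝ n Φ a) {A : E ≃L[ℝ] F}
    (hA : HasFDerivAt Φ (A : E →L[ℝ] F) a) : Φ '' S ∈ 𝓝 (Φ a) := by
  have h := (hΦ.hasStrictFDerivAt' hA hn).map_nhds_eq_of_equiv
  rw [← h]
  exact image_mem_map hS

theorem ContDiffAt.of_leftInvOn {n : WithTop ℕ∞} (hn : n ≠ 0) {Φ : E → F} {a : E}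
    {S : Set E} (hS : S ∈ 𝓝 a) (hΦ : ContDiffAt ℝ n Φ a) {A : E ≃L[ℝ] F}
    (hA : HasFDerivAt Φ (A : E →L[ℝ] F) a) {G : F → E} (hG : LeftInvOn G Φ S) :
    ContDiffAt ℝ n G (Φ a) := by
  refine (hΦ.to_localInverse hA hn).congr_of_eventuallyEq ?_
  have hst := hΦ.hasStrictFDerivAt' hA hn
  have hcont : Tendsto (hΦ.localInverse hA hn) (𝓝 (Φ a)) (𝓝 a) := hst.localInverse_tendsto
  filter_upwards [hst.eventually_right_inverse, hcont hS] with y hy hyS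
  conv_lhs => rw [← hy]
  exact hG hyS

end LeftInverse

/-! ### Determinants and vector products under linear maps. -/

section Determinant

theorem det_space3 (A : Space3 →L[ℝ] Space3) : A.det =
    inner ℝ (cross3 (A (EuclideanSpace.single 0 1)) (A (EuclideanSpace.single 1 1)))
      (A (EuclideanSpace.single 2 1)) := by
  rw [ContinuousLinearMap.det,
    ← LinearMap.det_toMatrix (EuclideanSpace.basisFun (Fin 3) ℝ).toBasis, Matrix.det_fin_three]
  simp only [LinearMap.toMatrix_apply, inner_space3, cross3_zero, cross3_one, cross3_two,
    OrthonormalBasis.coe_toBasis, EuclideanSpace.basisFun_apply,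
    OrthonormalBasis.coe_toBasis_repr_apply, EuclideanSpace.basisFun_repr,
    ContinuousLinearMap.coe_coe]
  ring

/-- The vector product of two covectors transforms under `A` with the factor `det A`. -/
theorem det_smul_cross3 (A : Space3 →L[ℝ] Space3) {n m ν μ : Space3}
    (hν : ∀ w, inner ℝ n (A w) = inner ℝ ν w) (hμ : ∀ w, inner ℝ m (A w) = inner ℝ μ w) :
    A.det • cross3 n m = A (cross3 ν μ) := by
  have hcoord (n ν : Space3) (h : ∀ w, inner ℝ n (A w) = inner ℝ ν w) (i : Fin 3) :
      ν i = n 0 * A (EuclideanSpace.single i 1) 0 + n 1 * A (EuclideanSpace.single i 1) 1 +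
        n 2 * A (EuclideanSpace.single i 1) 2 := by
    rw [← inner_space3, h]; simp only [inner_space3]; fin_cases i <;> simp
  ext i
  rw [clm_apply_coord_space3 A, det_space3]
  simp only [inner_space3, cross3_zero, cross3_one, cross3_two, hcoord n ν hν, hcoord m μ hμ,
    PiLp.smul_apply, smul_eq_mul]
  fin_cases i <;>
    simp only [Fin.zero_eta, Fin.mk_one, Fin.reduceFinMk, cross3_zero, cross3_one, cross3_two] <;>
    ring

theorem DifferentiableAt.det_space3 {A : ℝ → Space3 →L[ℝ] Space3} {t : ℝ}
    (hA : DifferentiableAt ℝ A t) : DifferentiableAt ℝ (fun τ => (A τ).det) t := by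
  have h (j i : Fin 3) : DifferentiableAt ℝ (fun τ => A τ (EuclideanSpace.single j 1) i) t :=
    (EuclideanSpace.proj i : Space3 →L[ℝ] ℝ).differentiableAt.comp t
      (hA.clm_apply (differentiableAt_const (EuclideanSpace.single j (1 : ℝ))))
  simp only [_root_.det_space3, inner_space3, cross3_zero, cross3_one, cross3_two]
  fun_prop

end Determinant

/-! ### Regularity of the flow and conservation in the reference space. -/

namespace FluidMotion

variable {r : WithTop ℕ∞} (M : FluidMotion r)

/-- The space-time map `(t, X) ↦ (t, φ t X)`. -/
def flow (Z : ℝ × Space3) : ℝ × Space3 := (Z.1, M.φ Z.1 Z.2)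

theorem isOpen_dom : IsOpen (M.time ×ˢ M.D₀) := M.isOpen_time.prod M.isOpen_D₀

theorem contDiffAt_φ {t : ℝ} (ht : t ∈ M.time) {X : Space3} (hX : X ∈ M.D₀) :
    ContDiffAt ℝ r (fun Z : ℝ × Space3 => M.φ Z.1 Z.2) (t, X) :=
  M.contDiffOn_φ.contDiffAt (M.isOpen_dom.mem_nhds ⟨ht, hX⟩)

theorem hasFDerivAt_φ (hr : r ≠ 0) {t : ℝ} (ht : t ∈ M.time) {X : Space3} (hX : X ∈ M.D₀) :
    HasFDerivAt (M.φ t) (M.F t X) X :=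
  (((M.contDiffAt_φ ht hX).differentiableAt hr).comp (f := fun X => (t, X)) X
    (differentiableAt_const t |>.prodMk differentiableAt_id)).hasFDerivAt

theorem fderiv_φ_comp_inr (hr : r ≠ 0) {t : ℝ} (ht : t ∈ M.time) {X : Space3} (hX : X ∈ M.D₀) :
    (fderiv ℝ (fun Z : ℝ × Space3 => M.φ Z.1 Z.2) (t, X)).comp (ContinuousLinearMap.inr ℝ ℝ Space3)
      = M.F t X :=
  ((((M.contDiffAt_φ ht hX).differentiableAt hr).hasFDerivAt.comp (f := fun X => (t, X)) X
    (hasFDerivAt_prodMk_right t X)).unique (M.hasFDerivAt_φ hr ht hX))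

theorem contDiffAt_flow {t : ℝ} (ht : t ∈ M.time) {X : Space3} (hX : X ∈ M.D₀) :
    ContDiffAt ℝ r M.flow (t, X) :=
  contDiffAt_fst.prodMk (M.contDiffAt_φ ht hX)

/-- The derivative is block triangular, with diagonal blocks the identity in time and the invertible
`F` in space. -/
theorem exists_equiv_hasFDerivAt_flow (hr : r ≠ 0) {t : ℝ} (ht : t ∈ M.time) {X : Space3}
    (hX : X ∈ M.D₀) : ∃ A : (ℝ × Space3) ≃L[ℝ] (ℝ × Space3),
      HasFDerivAt M.flow (A : (ℝ × Space3) →L[ℝ] (ℝ × Space3)) (t, X) := by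
  obtain ⟨B, hB⟩ := M.isInvertible_fderiv t ht X hX
  set T := fderiv ℝ (fun Z : ℝ × Space3 => M.φ Z.1 Z.2) (t, X)
  refine ⟨(ContinuousLinearEquiv.refl ℝ ℝ).skewProd B
    (T.comp (ContinuousLinearMap.inl ℝ ℝ Space3)), ?_⟩
  have h : HasFDerivAt M.flow _ (t, X) :=
    hasFDerivAt_fst.prodMk ((M.contDiffAt_φ ht hX).differentiableAt hr).hasFDerivAt
  refine h.congr_fderiv ?_
  have hBX : ∀ w, B w = T (0, w) := fun w => by
    have h1 := M.fderiv_φ_comp_inr hr ht hX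
    rw [F, ← hB] at h1
    simpa using congrArg (fun A : Space3 →L[ℝ] Space3 => A w) h1.symm
  refine ContinuousLinearMap.ext fun p => ?_
  have hp : T p = T (0, p.2) + T (p.1, 0) := by
    rw [← T.map_add, Prod.mk_add_mk, zero_add, add_zero]
  refine Prod.ext rfl ?_
  change T p = B p.2 + T (p.1, 0)
  rw [hBX, hp]

theorem isOpen_tube (hr : r ≠ 0) {O : Set Space3} (hO : IsOpen O) (hOD : O ⊆ M.D₀) :
    IsOpen (M.tube O) := by
  rw [isOpen_iff_mem_nhds]
  rintro ⟨t, x⟩ ⟨ht, X, hX, hx⟩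
  obtain ⟨A, hA⟩ := M.exists_equiv_hasFDerivAt_flow hr ht (hOD hX)
  have h := (M.contDiffAt_flow ht (hOD hX)).image_mem_nhds_of_equiv hr
    ((M.isOpen_time.prod hO).mem_nhds (show (t, X) ∈ M.time ×ˢ O from ⟨ht, hX⟩)) hA
  rw [show M.flow (t, X) = (t, x) from Prod.ext rfl hx] at h
  refine mem_of_superset h ?_
  rintro _ ⟨⟨τ, Y⟩, ⟨hτ, hY⟩, rfl⟩
  exact ⟨hτ, Y, hY, rfl⟩

theorem mem_spaceTime {t : ℝ} (ht : t ∈ M.time) {X : Space3} (hX : X ∈ M.D₀) :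
    (t, M.φ t X) ∈ M.spaceTime := ⟨ht, X, hX, rfl⟩

theorem spaceTime_mem_nhds (hr : r ≠ 0) {t : ℝ} (ht : t ∈ M.time) {X : Space3} (hX : X ∈ M.D₀) :
    M.spaceTime ∈ 𝓝 (t, M.φ t X) :=
  (M.isOpen_tube hr M.isOpen_D₀ Subset.rfl).mem_nhds (M.mem_spaceTime ht hX)

/-- The label `X` of the particle which is at `x` at time `t`. -/
noncomputable def label (t : ℝ) (x : Space3) : Space3 := Function.invFunOn (M.φ t) M.D₀ x

theorem label_φ {t : ℝ} (ht : t ∈ M.time) {X : Space3} (hX : X ∈ M.D₀) :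
    M.label t (M.φ t X) = X :=
  (M.injOn_φ t ht).leftInvOn_invFunOn hX

theorem contDiffAt_label (hr : r ≠ 0) {t : ℝ} (ht : t ∈ M.time) {X : Space3} (hX : X ∈ M.D₀) :
    ContDiffAt ℝ r (fun z : ℝ × Space3 => M.label z.1 z.2) (t, M.φ t X) := by
  obtain ⟨A, hA⟩ := M.exists_equiv_hasFDerivAt_flow hr ht hX
  have h : ContDiffAt ℝ r (fun z : ℝ × Space3 => (z.1, M.label z.1 z.2)) (M.flow (t, X)) :=
    (M.contDiffAt_flow ht hX).of_leftInvOn hr (M.isOpen_dom.mem_nhds ⟨ht, hX⟩) hA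
      fun Z hZ => Prod.ext rfl (M.label_φ hZ.1 hZ.2)
  exact contDiffAt_snd.comp _ h

theorem differentiableAt_path (hr : r ≠ 0) {t : ℝ} (ht : t ∈ M.time) {X : Space3}
    (hX : X ∈ M.D₀) : DifferentiableAt ℝ (fun τ => (τ, M.φ τ X)) t :=
  differentiableAt_id.prodMk (((M.contDiffAt_φ ht hX).differentiableAt hr).comp
    (f := fun τ => (τ, X)) t (differentiableAt_id.prodMk (differentiableAt_const X)))

theorem differentiableAt_along {V : Type*} [NormedAddCommGroup V] [NormedSpace ℝ V]
    {n : WithTop ℕ∞} (hn : n ≠ 0) (hr : r ≠ 0) {f : ℝ → Space3 → V}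
    (hf : ContDiffOn ℝ n (fun z : ℝ × Space3 => f z.1 z.2) M.spaceTime)
    {t : ℝ} (ht : t ∈ M.time) {X : Space3} (hX : X ∈ M.D₀) :
    DifferentiableAt ℝ (fun τ => f τ (M.φ τ X)) t :=
  ((hf.contDiffAt (M.spaceTime_mem_nhds hr ht hX)).differentiableAt hn).comp
    (f := fun τ => (τ, M.φ τ X)) t (M.differentiableAt_path hr ht hX)

/-- Since `deriv` is `0` where a function is not differentiable, a vanishing Lie derivative yields
constancy only together with differentiability, which each use has to supply. -/
theorem eq_of_deriv_eq_zero {V : Type*} [NormedAddCommGroup V] [NormedSpace ℝ V] {g : ℝ → V}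
    (hg : ∀ t ∈ M.time, DifferentiableAt ℝ g t) (hg' : ∀ t ∈ M.time, deriv g t = 0)
    {t t' : ℝ} (ht : t ∈ M.time) (ht' : t' ∈ M.time) : g t = g t' :=
  M.isOpen_time.is_const_of_deriv_eq_zero M.ordConnected_time.isPreconnected
    (fun t ht => (hg t ht).differentiableWithinAt) hg' ht ht'

theorem differentiableAt_F {k : WithTop ℕ∞} (hk : k ≠ 0) (M : FluidMotion (k + 1)) {t : ℝ}
    (ht : t ∈ M.time) {X : Space3} (hX : X ∈ M.D₀) :
    DifferentiableAt ℝ (fun τ => M.F τ X) t := by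
  have h1 : ContDiffAt ℝ k (fderiv ℝ fun Z : ℝ × Space3 => M.φ Z.1 Z.2) (t, X) :=
    (M.contDiffAt_φ ht hX).fderiv_right le_rfl
  have h2 : DifferentiableAt ℝ (fun τ : ℝ =>
      fderiv ℝ (fun Z : ℝ × Space3 => M.φ Z.1 Z.2) (τ, X)) t :=
    (h1.differentiableAt hk).comp (f := fun τ => (τ, X)) t
      (differentiableAt_id.prodMk (differentiableAt_const X))
  refine (h2.clm_comp (differentiableAt_const
    (ContinuousLinearMap.inr ℝ ℝ Space3))).congr_of_eventuallyEq ?_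
  filter_upwards [M.isOpen_time.mem_nhds ht] with τ hτ
  exact (M.fderiv_φ_comp_inr (by simp) hτ hX).symm

theorem contDiffAt_slice {V : Type*} [NormedAddCommGroup V] [NormedSpace ℝ V]
    {n : WithTop ℕ∞} (hr : r ≠ 0) {f : ℝ → Space3 → V}
    (hf : ContDiffOn ℝ n (fun z : ℝ × Space3 => f z.1 z.2) M.spaceTime)
    {t : ℝ} (ht : t ∈ M.time) {X : Space3} (hX : X ∈ M.D₀) :
    ContDiffAt ℝ n (f t) (M.φ t X) :=
  (hf.contDiffAt (M.spaceTime_mem_nhds hr ht hX)).comp (f := fun x => (t, x)) _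
    (contDiffAt_const.prodMk contDiffAt_id)

theorem isOpen_image_φ (hr : r ≠ 0) {t : ℝ} (ht : t ∈ M.time) : IsOpen (M.φ t '' M.D₀) := by
  convert (M.isOpen_tube hr M.isOpen_D₀ Subset.rfl).preimage (Continuous.prodMk_right t) using 1
  ext x
  simp [tube, ht]

theorem scalar_eq_of_moves {s : ℝ → Space3 → ℝ} {n : WithTop ℕ∞} (hn : n ≠ 0) (hr : r ≠ 0)
    (hs : ContDiffOn ℝ n (fun z : ℝ × Space3 => s z.1 z.2) M.spaceTime)
    (hm : M.ScalarMoves M.D₀ s) {t t' : ℝ} (ht : t ∈ M.time) (ht' : t' ∈ M.time) {X : Space3}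
    (hX : X ∈ M.D₀) : s t (M.φ t X) = s t' (M.φ t' X) :=
  M.eq_of_deriv_eq_zero (fun _ hτ => M.differentiableAt_along hn hr hs hτ hX)
    (fun τ hτ => hm τ hτ X hX) ht ht'

theorem inverse_F_apply {t : ℝ} (ht : t ∈ M.time) {X : Space3} (hX : X ∈ M.D₀) (w : Space3) :
    M.F t X ((M.F t X).inverse w) = w := by
  obtain ⟨B, hB⟩ := M.isInvertible_fderiv t ht X hX
  rw [F, ← hB, ContinuousLinearMap.inverse_equiv]
  exact B.apply_symm_apply w

theorem F_injective {t : ℝ} (ht : t ∈ M.time) {X : Space3} (hX : X ∈ M.D₀) :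
    Function.Injective (M.F t X) := by
  obtain ⟨B, hB⟩ := M.isInvertible_fderiv t ht X hX
  rw [F, ← hB]
  exact B.injective

theorem det_F_ne_zero {t : ℝ} (ht : t ∈ M.time) {X : Space3} (hX : X ∈ M.D₀) :
    (M.F t X).det ≠ 0 := by
  obtain ⟨B, hB⟩ := M.isInvertible_fderiv t ht X hX
  rw [F, ← hB]
  exact B.toLinearEquiv.isUnit_det'.ne_zero

theorem vector_eq_of_moves {k n : WithTop ℕ∞} (hk : k ≠ 0) (hn : n ≠ 0) (M : FluidMotion (k + 1))
    {J : ℝ → Space3 → Space3}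
    (hJ : ContDiffOn ℝ n (fun z : ℝ × Space3 => J z.1 z.2) M.spaceTime)
    (hm : M.VectorMoves M.D₀ J) {t t' : ℝ} (ht : t ∈ M.time) (ht' : t' ∈ M.time) {X : Space3}
    (hX : X ∈ M.D₀) :
    (M.F t X).inverse (J t (M.φ t X)) = (M.F t' X).inverse (J t' (M.φ t' X)) := by
  refine M.eq_of_deriv_eq_zero (g := fun τ => (M.F τ X).inverse (J τ (M.φ τ X)))
    (fun τ hτ => ?_) (fun τ hτ => ?_) ht ht'
  · have hinv : DifferentiableAt ℝ (ContinuousLinearMap.inverse :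
        (Space3 →L[ℝ] Space3) → Space3 →L[ℝ] Space3) (M.F τ X) :=
      (ContinuousLinearMap.IsInvertible.contDiffAt_map_inverse (n := 1)
        (M.isInvertible_fderiv τ hτ X hX)).differentiableAt one_ne_zero
    exact (hinv.comp τ (differentiableAt_F hk M hτ hX)).clm_apply
      (M.differentiableAt_along hn (by simp) hJ hτ hX)
  · exact M.F_injective hτ hX ((hm τ hτ X hX).trans (map_zero _).symm)

theorem threeForm_eq_of_moves {k n : WithTop ℕ∞} (hk : k ≠ 0) (hn : n ≠ 0)
    (M : FluidMotion (k + 1)) {ρ : ℝ → Space3 → ℝ}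
    (hρ : ContDiffOn ℝ n (fun z : ℝ × Space3 => ρ z.1 z.2) M.spaceTime)
    (hm : M.ThreeFormMoves M.D₀ ρ) {t t' : ℝ} (ht : t ∈ M.time) (ht' : t' ∈ M.time) {X : Space3}
    (hX : X ∈ M.D₀) :
    ρ t (M.φ t X) * (M.F t X).det = ρ t' (M.φ t' X) * (M.F t' X).det := by
  refine M.eq_of_deriv_eq_zero (g := fun τ => ρ τ (M.φ τ X) * (M.F τ X).det)
    (fun τ hτ => ?_) (fun τ hτ => ?_) ht ht'
  · exact (M.differentiableAt_along hn (by simp) hρ hτ hX).mul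
      (differentiableAt_F hk M hτ hX).det_space3
  · exact (mul_eq_zero.1 (hm τ hτ X hX)).resolve_left (inv_ne_zero (M.det_F_ne_zero hτ hX))

/-- If the pullbacks of two scalar fields to the reference space do not depend on time,
then neither does the pullback of the flux `grad s × grad η`. -/
theorem flux_eq_of_pullback_eq (hr : r ≠ 0) {s η : ℝ → Space3 → ℝ} {t t₀ : ℝ} (ht : t ∈ M.time)
    (ht₀ : t₀ ∈ M.time) {X : Space3} (hX : X ∈ M.D₀)
    (hs : DifferentiableAt ℝ (s t) (M.φ t X)) (hs₀ : DifferentiableAt ℝ (s t₀) (M.φ t₀ X))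
    (hη : DifferentiableAt ℝ (η t) (M.φ t X)) (hη₀ : DifferentiableAt ℝ (η t₀) (M.φ t₀ X))
    (hss : ∀ᶠ Y in 𝓝 X, s t (M.φ t Y) = s t₀ (M.φ t₀ Y))
    (hηη : ∀ᶠ Y in 𝓝 X, η t (M.φ t Y) = η t₀ (M.φ t₀ Y)) {j : Space3} {q q₀ : ℝ}
    (hq : q * (M.F t X).det = q₀ * (M.F t₀ X).det)
    (h₀ : q₀ • M.F t₀ X j = cross3 (∇ (s t₀) (M.φ t₀ X)) (∇ (η t₀) (M.φ t₀ X))) :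
    q • M.F t X j = cross3 (∇ (s t) (M.φ t X)) (∇ (η t) (M.φ t X)) := by
  have hpull {f : ℝ → Space3 → ℝ} {τ : ℝ} (hτ : τ ∈ M.time)
      (hf : DifferentiableAt ℝ (f τ) (M.φ τ X)) (w : Space3) :
      inner ℝ (∇ (f τ) (M.φ τ X)) (M.F τ X w) =
        inner ℝ (∇ (fun Y => f τ (M.φ τ Y)) X) w := by
    rw [inner_gradient_space3, inner_gradient_space3]
    have h : HasFDerivAt (fun Y => f τ (M.φ τ Y)) _ X :=
      hf.hasFDerivAt.comp X (M.hasFDerivAt_φ hr hτ hX)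
    rw [h.fderiv, ContinuousLinearMap.comp_apply]
  have hgrad {f : ℝ → Space3 → ℝ} (h : ∀ᶠ Y in 𝓝 X, f t (M.φ t Y) = f t₀ (M.φ t₀ Y)) :
      ∇ (fun Y => f t (M.φ t Y)) X = ∇ (fun Y => f t₀ (M.φ t₀ Y)) X := by
    rw [gradient, gradient, Filter.EventuallyEq.fderiv_eq h]
  -- The right-hand sides at `t` and `t₀` involve the same pulled-back gradients, so their vector
  -- product can be eliminated.
  have h1 := det_smul_cross3 (M.F t X) (hpull ht hs) (hpull ht hη)
  have h2 := det_smul_cross3 (M.F t₀ X) (hpull ht₀ hs₀) (hpull ht₀ hη₀)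
  rw [← h₀, smul_smul, ← map_smul] at h2
  rw [hgrad hss, hgrad hηη, ← M.F_injective ht₀ hX h2, mul_comm, ← hq, map_smul, mul_comm,
    mul_smul] at h1
  exact (smul_right_injective _ (M.det_F_ne_zero ht hX) h1).symm

end FluidMotion

end FluidMotionProof

/-! ### The representation of `ρ J`. -/

theorem mainTheorem10 (k : ℕ∞) (hk : 1 ≤ k)
    (M : FluidMotion ((k : WithTop ℕ∞) + 1))
    (ρ s : ℝ → Space3 → ℝ) (J : ℝ → Space3 → Space3)
    (hρ : ContDiffOn ℝ k (fun z : ℝ × Space3 => ρ z.1 z.2) M.spaceTime)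
    (hJ : ContDiffOn ℝ k (fun z : ℝ × Space3 => J z.1 z.2) M.spaceTime)
    (hs : ContDiffOn ℝ ((k : WithTop ℕ∞) + 1) (fun z : ℝ × Space3 => s z.1 z.2) M.spaceTime)
    (hρ_moves : M.ThreeFormMoves M.D₀ ρ)
    (hs_moves : M.ScalarMoves M.D₀ s)
    (hJ_moves : M.VectorMoves M.D₀ J)
    (hsJ : ∀ z ∈ M.spaceTime, fderiv ℝ (s z.1) z.2 (J z.1 z.2) = 0)
    (hdiv : ∀ z ∈ M.spaceTime, div3 (fun x => ρ z.1 x • J z.1 x) z.2 = 0)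
    (t₀ : ℝ) (ht₀ : t₀ ∈ M.time) (X₀ : Space3) (hX₀ : X₀ ∈ M.D₀)
    (hgrad : ∇ (s t₀) (M.φ t₀ X₀) ≠ 0) :
    ∃ O : Set Space3, IsOpen O ∧ X₀ ∈ O ∧ O ⊆ M.D₀ ∧
      ∃ (η : ℝ → Space3 → ℝ) (f : ℝ × ℝ → ℝ),
        ContDiffOn ℝ k (fun z : ℝ × Space3 => η z.1 z.2) (M.tube O) ∧
        ContDiff ℝ k f ∧
        M.ScalarMoves O η ∧
        ∀ z ∈ M.tube O,
          ρ z.1 z.2 • J z.1 z.2 =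
            f (s z.1 z.2, η z.1 z.2) • cross3 (∇ (s z.1) z.2) (∇ (η z.1) z.2) := by
  have hk1 : (1 : WithTop ℕ∞) ≤ k := by exact_mod_cast hk
  have hk0 : (k : WithTop ℕ∞) ≠ 0 := (zero_lt_one.trans_le hk1).ne'
  have hr : (k : WithTop ℕ∞) + 1 ≠ 0 := by simp
  have hkr : (k : WithTop ℕ∞) ≤ k + 1 := le_self_add
  obtain ⟨V, hVU, hVo, hxV, η₀, hη₀, hflux⟩ := exists_clebsch_potential hk
    (M.isOpen_image_φ hr ht₀) (x₀ := M.φ t₀ X₀) ⟨X₀, hX₀, rfl⟩ (s := s t₀)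
    (v := fun x => ρ t₀ x • J t₀ x)
    (by
      rintro _ ⟨X, hX, rfl⟩
      exact (M.contDiffAt_slice hr hs ht₀ hX).contDiffWithinAt)
    (by
      rintro _ ⟨X, hX, rfl⟩
      exact ((M.contDiffAt_slice hr hρ ht₀ hX).smul
        (M.contDiffAt_slice hr hJ ht₀ hX)).contDiffWithinAt)
    (by
      rintro _ ⟨X, hX, rfl⟩
      rw [map_smul, hsJ _ (M.mem_spaceTime ht₀ hX), smul_zero])
    (by
      rintro _ ⟨X, hX, rfl⟩
      exact hdiv _ (M.mem_spaceTime ht₀ hX))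
    hgrad
  have hφc : ContinuousOn (M.φ t₀) M.D₀ := fun X hX =>
    (M.hasFDerivAt_φ hr ht₀ hX).continuousAt.continuousWithinAt
  have hOo : IsOpen (M.D₀ ∩ M.φ t₀ ⁻¹' V) := hφc.isOpen_inter_preimage M.isOpen_D₀ hVo
  -- The value of `η` at `(t, x)` is that of `η₀` where the same particle was at time `t₀`.
  set η : ℝ → Space3 → ℝ := fun t x => η₀ (M.φ t₀ (M.label t x)) with hη
  have hη_φ {t : ℝ} (ht : t ∈ M.time) {X : Space3} (hX : X ∈ M.D₀) :
      η t (M.φ t X) = η₀ (M.φ t₀ X) := by rw [hη]; simp only [M.label_φ ht hX]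
  have hηc {t : ℝ} (ht : t ∈ M.time) {X : Space3} (hX : X ∈ M.D₀ ∩ M.φ t₀ ⁻¹' V) :
      ContDiffAt ℝ k (fun z : ℝ × Space3 => η z.1 z.2) (t, M.φ t X) := by
    have h1 : ContDiffAt ℝ k (fun Y => η₀ (M.φ t₀ Y)) (M.label t (M.φ t X)) := by
      rw [M.label_φ ht hX.1]
      have hφ : ContDiffAt ℝ k (M.φ t₀) X := ((M.contDiffAt_φ ht₀ hX.1).of_le hkr).comp
        (f := fun X => (t₀, X)) X (contDiffAt_const.prodMk contDiffAt_id)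
      exact (hη₀.contDiffAt (hVo.mem_nhds hX.2)).comp X hφ
    exact h1.comp (f := fun z : ℝ × Space3 => M.label z.1 z.2) (t, M.φ t X)
      ((M.contDiffAt_label hr ht hX.1).of_le hkr)
  have hηd {t : ℝ} (ht : t ∈ M.time) {X : Space3} (hX : X ∈ M.D₀ ∩ M.φ t₀ ⁻¹' V) :
      DifferentiableAt ℝ (η t) (M.φ t X) :=
    ((hηc ht hX).differentiableAt hk0).comp (f := fun x => (t, x)) _
      ((differentiableAt_const t).prodMk differentiableAt_id)
  refine ⟨M.D₀ ∩ M.φ t₀ ⁻¹' V, hOo, ⟨hX₀, hxV⟩, inter_subset_left, η, fun _ => 1, ?_,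
    contDiff_const, ?_, ?_⟩
  · rintro ⟨t, x⟩ ⟨ht, X, hX, hx⟩
    obtain rfl : M.φ t X = x := hx
    replace ht : t ∈ M.time := ht
    exact (hηc ht hX).contDiffWithinAt
  · intro t ht X hX
    have : (fun τ => η τ (M.φ τ X)) =ᶠ[nhds t] fun _ => η₀ (M.φ t₀ X) := by
      filter_upwards [M.isOpen_time.mem_nhds ht] with τ hτ
      exact hη_φ hτ hX.1
    rw [FluidMotion.lieScalar, this.deriv_eq, deriv_const]
  · rintro ⟨t, x⟩ ⟨ht, X, hX, hx⟩
    obtain rfl : M.φ t X = x := hx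
    replace ht : t ∈ M.time := ht
    have hη_t₀ : η t₀ =ᶠ[nhds (M.φ t₀ X)] η₀ := by
      filter_upwards [(M.isOpen_image_φ hr ht₀).mem_nhds ⟨X, hX.1, rfl⟩]
      rintro _ ⟨Y, hY, rfl⟩
      exact hη_φ ht₀ hY
    have hj₀ := M.inverse_F_apply ht₀ hX.1 (J t₀ (M.φ t₀ X))
    have hj := M.inverse_F_apply ht hX.1 (J t (M.φ t X))
    rw [FluidMotion.vector_eq_of_moves hk0 hk0 M hJ hJ_moves ht ht₀ hX.1] at hj
    have h := M.flux_eq_of_pullback_eq hr (s := s) (η := η) ht ht₀ hX.1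
      ((M.contDiffAt_slice hr hs ht hX.1).differentiableAt hr)
      ((M.contDiffAt_slice hr hs ht₀ hX.1).differentiableAt hr) (hηd ht hX) (hηd ht₀ hX)
      (by
        filter_upwards [M.isOpen_D₀.mem_nhds hX.1] with Y hY
        exact M.scalar_eq_of_moves hr hr hs hs_moves ht ht₀ hY)
      (by
        filter_upwards [M.isOpen_D₀.mem_nhds hX.1] with Y hY
        rw [hη_φ ht hY, hη_φ ht₀ hY])
      (FluidMotion.threeForm_eq_of_moves hk0 hk0 M hρ hρ_moves ht ht₀ hX.1)
      (j := (M.F t₀ X).inverse (J t₀ (M.φ t₀ X)))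
      (by
        rw [hj₀, show ∇ (η t₀) (M.φ t₀ X) = ∇ η₀ (M.φ t₀ X) by
          rw [gradient, gradient, hη_t₀.fderiv_eq]]
        exact hflux _ hX.2)
    rw [hj] at h
    rw [one_smul]
    exact h
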